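/- There is an absolute constant $C>0$ such that the following holds for all integers $n\ge 1$ and $d\ge 0$ and all vertices $s,t\in\{1,\dots,n\}$. There is a quantum query algorithm, depending only on $n,d,s,t$, that makes at most $C\,n\sqrt d$ queries to the adjacency matrix $(x_{ij})$ of an unknown simple undirected graph $G$ on the vertex set $\{1,\dots,n\}$ and that decides, with error probability at most $1/3$, whether $s$ and $t$ are connected by a path in $G$, for every $G$ satisfying the promise that if $s$ and $t$ are connected by a path, then they are connected by a path of length at most $d$. That is, on every such $G$ the algorithm accepts with probability at least $2/3$ if $s$ and $t$ are connected, and with probability at most $1/3$ otherwise. Here a quantum query algorithm making $T$ queries acts on a Hilbert space with orthonormal basis $|(i,j),b,w\rangle$, where $(i,j)\in\{1,\dots,n\}^2$, $b\in\{0,1\}$ and $w$ ranges over a finite set of any size; it starts in a fixed basis state, applies $U_0, O_x, U_1, O_x,\dots,O_x,U_T$ in this order, with arbitrary unitaries $U_0,\dots,U_T$ independent of $G$ and $T$ uses of the oracle $O_x|(i,j),b,w\rangle=|(i,j),b\oplus x_{ij},w\rangle$, and finally measures in this basis and accepts if the outcome lies in a fixed set. -/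

import Mathlib

/-- A quantum query algorithm with oracle access to an unknown input `x : ι → Bool`.
Its Hilbert space is `ℂ^(ι × Bool × Work)`: an index register, a one-qubit answer register and a
finite-dimensional workspace of arbitrary size. The computation starts in a computational basis
state and applies `unitary 0`, oracle, `unitary 1`, oracle, …, oracle, `unitary queries`, i.e. it
makes exactly `queries` oracle calls, interleaved with input-independent unitaries; then all
registers are measured in the computational basis and the algorithm accepts if and only if the
outcome lies in `accepting`. The unitaries with index larger than `queries` are never used. -/
structure QuantumQueryAlgorithm (ι : Type) [Fintype ι] [DecidableEq ι] where
  Work : Type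
  workFintype : Fintype Work
  workDecidableEq : DecidableEq Work
  queries : ℕ
  unitary : ℕ → Matrix.unitaryGroup (ι × Bool × Work) ℂ
  start : ι × Bool × Work
  accepting : Finset (ι × Bool × Work)

attribute [instance] QuantumQueryAlgorithm.workFintype QuantumQueryAlgorithm.workDecidableEq

namespace QuantumQueryAlgorithm

/-- The standard oracle `|i, b, w⟩ ↦ |i, b ⊕ x i, w⟩`, extended linearly to state vectors
(given by their amplitudes; the basis permutation is its own inverse). -/
def oracle {ι W : Type} (x : ι → Bool) (ψ : ι × Bool × W → ℂ) : ι × Bool × W → ℂ :=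
  fun k => ψ (k.1, xor k.2.1 (x k.1), k.2.2)

variable {ι : Type} [Fintype ι] [DecidableEq ι]

/-- The state on input `x` after `k` oracle calls and the unitary that follows the last of them. -/
noncomputable def state (A : QuantumQueryAlgorithm ι) (x : ι → Bool) :
    ℕ → (ι × Bool × A.Work → ℂ)
  | 0 => (A.unitary 0).1.mulVec (Pi.single A.start 1)
  | k + 1 => (A.unitary (k + 1)).1.mulVec (oracle x (A.state x k))

/-- The probability that the algorithm accepts on input `x` (Born rule). -/
noncomputable def acceptProb (A : QuantumQueryAlgorithm ι) (x : ι → Bool) : ℝ :=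
  ∑ k ∈ A.accepting, ‖A.state x A.queries k‖ ^ 2

/-- With error probability at most `1/3` on each side, `A` decides whether an instance `a`
satisfies `yes a`, for all instances satisfying the promise, where the instance `a` is
accessed through oracle queries to `input a`. -/
def Decides (A : QuantumQueryAlgorithm ι) {α : Type} (input : α → ι → Bool)
    (promise yes : α → Prop) : Prop :=
  ∀ a, promise a →
    (yes a → 2 / 3 ≤ A.acceptProb (input a)) ∧ (¬ yes a → A.acceptProb (input a) ≤ 1 / 3)

end QuantumQueryAlgorithm

open Classical in
/-- The entries `x_{ij}` of the adjacency matrix of a simple graph on `n` vertices. -/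
noncomputable def adjacencyInput (n : ℕ) (G : SimpleGraph (Fin n)) : Fin n × Fin n → Bool :=
  fun e => decide (G.Adj e.1 e.2)

/-- The promise: if `s` and `t` are connected, then by a path of length at most `d`. -/
def ShortPathPromise {n : ℕ} (s t : Fin n) (d : ℕ) (G : SimpleGraph (Fin n)) : Prop :=
  G.Reachable s t → ∃ p : G.Walk s t, p.IsPath ∧ p.length ≤ d

/-! Give each ordered pair of vertices a coordinate, and add one marked coordinate for a virtual
edge joining `s` and `t`. Let `U` reflect about the circulations (the orthogonal complement of the
potential differences) and then negate the coordinates of absent edges. A path closed up by the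
virtual edge is a circulation fixed by `U`, of squared norm at most `a ^ 2 + d`, overlapping the
marked basis state in `a` (`exists_fixed_of_path`). If `s` and `t` are separated, the potential of
the component of `s` exhibits twice the marked state as `φ - U φ`
(`exists_coboundary_of_not_reachable`). So the average of `T` iterates of the marked state stays
long in the first case and has norm at most `‖φ‖ / T` in the second. `exists_phaseDetection` accepts
with the squared norm of that average after `T` queries. With `a ^ 2 = 2 * d` and `T ≥ 3 * n * √d`
the bounds are `2/3` and `1/3`. -/

open scoped InnerProductSpace

/-! ### Isometries as unitary matrices -/

/-- A linear map preserving the `ℓ²` norm is given by a unitary matrix. -/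
theorem exists_unitaryGroup_mulVec_eq {K : Type} [Fintype K] [DecidableEq K]
    (f : (K → ℂ) →ₗ[ℂ] (K → ℂ)) (hf : ∀ v, ∑ k, ‖f v k‖ ^ 2 = ∑ k, ‖v k‖ ^ 2) :
    ∃ M : Matrix.unitaryGroup K ℂ, ∀ v, M.1.mulVec v = f v := by
  let g : EuclideanSpace ℂ K →ₗᵢ[ℂ] EuclideanSpace ℂ K :=
    { toLinearMap := (WithLp.linearEquiv 2 ℂ (K → ℂ)).symm.toLinearMap ∘ₗ f ∘ₗ
        (WithLp.linearEquiv 2 ℂ (K → ℂ)).toLinearMap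
      norm_map' := fun v => by
        rw [EuclideanSpace.norm_eq, EuclideanSpace.norm_eq]
        exact congrArg Real.sqrt (hf v.ofLp) }
  refine ⟨⟨LinearMap.toMatrix' f, ?_⟩, fun v => LinearMap.toMatrix'_mulVec f v⟩
  rw [Matrix.mem_unitaryGroup_iff']
  ext i j
  have h := g.inner_map_map (EuclideanSpace.single i 1) (EuclideanSpace.single j 1)
  rw [PiLp.inner_apply] at h
  rw [Matrix.mul_apply, Matrix.one_apply]
  have h1 : ∀ i k, (g (EuclideanSpace.single i 1)) k = LinearMap.toMatrix' f k i := by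
    intro i k
    rw [LinearMap.toMatrix'_apply]
    change f (Pi.single i 1) k = _
    congr 2
  simp only [h1, EuclideanSpace.inner_single_left, map_one, one_mul] at h
  rw [PiLp.single_apply] at h
  rw [← h]
  refine Finset.sum_congr rfl fun k _ => ?_
  simp [Matrix.star_apply, mul_comm]

/-! ### Norms of sums along an orbit of an isometry -/

section Averaging

variable {E : Type*} [NormedAddCommGroup E] [InnerProductSpace ℂ E]

/-- The sum telescopes to `φ - U^[T] φ`, whose norm is at most `2 * ‖φ‖` whatever `T` is. -/
theorem norm_sum_iterate_le_of_coboundary (U : E →ₗᵢ[ℂ] E) (T : ℕ) (ψ φ : E)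
    (h : (2 : ℂ) • ψ = φ - U φ) :
    ‖∑ m ∈ Finset.range T, U^[m] ψ‖ ≤ ‖φ‖ := by
  have hsum : (2 : ℂ) • ∑ m ∈ Finset.range T, U^[m] ψ = φ - U^[T] φ := by
    induction T with
    | zero => simp
    | succ T ih =>
      have hT : (2 : ℂ) • U^[T] ψ = U^[T] φ - U^[T + 1] φ := by
        have hlin : ∀ (k : ℕ) (v : E), U^[k] v = (U.toLinearMap ^ k) v := fun k v => by
          rw [Module.End.pow_apply]; rfl
        rw [hlin, ← map_smul, h, map_sub, ← hlin, ← hlin, ← Function.iterate_succ_apply]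
      rw [Finset.sum_range_succ, smul_add, ih, hT]
      abel
  have hn : ∀ k : ℕ, ‖U^[k] φ‖ = ‖φ‖ := by
    intro k
    induction k with
    | zero => rfl
    | succ k ih => rw [Function.iterate_succ_apply', U.norm_map, ih]
  have h2 := congrArg norm hsum
  rw [norm_smul] at h2
  have h3 := norm_sub_le φ (U^[T] φ)
  rw [hn, ← h2] at h3
  norm_num at h3
  linarith

/-- All iterates of `ψ` have the same inner product with a fixed vector, so Cauchy–Schwarz applies
to their sum. -/
theorem norm_inner_le_norm_mul_norm_sum_iterate (U : E →ₗᵢ[ℂ] E) (T : ℕ) (ψ φ : E)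
    (h : U φ = φ) :
    T * ‖⟪φ, ψ⟫_ℂ‖ ≤ ‖φ‖ * ‖∑ m ∈ Finset.range T, U^[m] ψ‖ := by
  have hm : ∀ m : ℕ, ⟪φ, U^[m] ψ⟫_ℂ = ⟪φ, ψ⟫_ℂ := by
    intro m
    induction m with
    | zero => rfl
    | succ m ih =>
      rw [Function.iterate_succ_apply']
      conv_lhs => rw [← h]
      rw [U.inner_map_map, ih]
  refine le_trans (le_of_eq ?_) (norm_inner_le_norm (𝕜 := ℂ) φ _)
  rw [inner_sum, Finset.sum_congr rfl fun m _ => hm m]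
  simp

end Averaging

/-! ### Implementing the average by queries -/

section PhaseDetection

variable {ι : Type}

/-- The phase oracle `|i, b⟩ ↦ (-1) ^ (b ∧ x i) |i, b⟩`. -/
noncomputable def phaseOracle [Fintype ι] (x : ι → Bool) :
    EuclideanSpace ℂ (ι × Bool) →ₗᵢ[ℂ] EuclideanSpace ℂ (ι × Bool) where
  toFun v := WithLp.toLp 2 fun j => if (j.2 && x j.1) then -v j else v j
  map_add' v w := by
    ext j
    simp only [PiLp.add_apply]
    split_ifs <;> ring
  map_smul' c v := by
    ext j
    simp only [PiLp.smul_apply, smul_eq_mul, RingHom.id_apply]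
    split_ifs <;> ring
  norm_map' v := by
    rw [EuclideanSpace.norm_eq, EuclideanSpace.norm_eq]
    congr 1
    refine Finset.sum_congr rfl fun j _ => ?_
    simp only [LinearMap.coe_mk, AddHom.coe_mk]
    split_ifs <;> simp

@[simp] theorem phaseOracle_apply [Fintype ι] (x : ι → Bool) (v : EuclideanSpace ℂ (ι × Bool))
    (j : ι × Bool) :
    phaseOracle x v j = if (j.2 && x j.1) then -v j else v j := rfl

/-- The Hadamard gate on the answer register. -/
noncomputable def hadamardAnswer (ι W : Type) :
    (ι × Bool × W → ℂ) →ₗ[ℂ] (ι × Bool × W → ℂ) where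
  toFun v k := ((Real.sqrt 2)⁻¹ : ℝ) *
    (v (k.1, false, k.2.2) + if k.2.1 then -v (k.1, true, k.2.2) else v (k.1, true, k.2.2))
  map_add' v w := by
    ext k
    simp only [Pi.add_apply]
    split_ifs <;> ring
  map_smul' c v := by
    ext k
    simp only [Pi.smul_apply, smul_eq_mul, RingHom.id_apply]
    split_ifs <;> ring

theorem hadamardAnswer_apply {W : Type} (v : ι × Bool × W → ℂ) (k : ι × Bool × W) :
    hadamardAnswer ι W v k = ((Real.sqrt 2)⁻¹ : ℝ) *
      (v (k.1, false, k.2.2) + if k.2.1 then -v (k.1, true, k.2.2) else v (k.1, true, k.2.2)) :=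
  rfl

theorem ofReal_inv_sqrt_two_mul_self :
    (((Real.sqrt 2)⁻¹ : ℝ) : ℂ) * (((Real.sqrt 2)⁻¹ : ℝ) : ℂ) = 1 / 2 := by
  rw [← Complex.ofReal_mul, ← mul_inv, Real.mul_self_sqrt (by norm_num)]
  norm_num

theorem sum_norm_sq_hadamardAnswer [Fintype ι] {W : Type} [Fintype W] (v : ι × Bool × W → ℂ) :
    ∑ k, ‖hadamardAnswer ι W v k‖ ^ 2 = ∑ k, ‖v k‖ ^ 2 := by
  simp only [Fintype.sum_prod_type, Fintype.sum_bool]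
  refine Finset.sum_congr rfl fun i _ => ?_
  rw [← Finset.sum_add_distrib, ← Finset.sum_add_distrib]
  refine Finset.sum_congr rfl fun w _ => ?_
  have hp := parallelogram_law_with_norm ℝ (v (i, false, w)) (v (i, true, w))
  have hs : (Real.sqrt 2)⁻¹ ^ 2 = (1 / 2 : ℝ) := by
    rw [inv_pow, Real.sq_sqrt (by norm_num)]; norm_num
  simp only [hadamardAnswer_apply, norm_mul, mul_pow, Complex.norm_real, Real.norm_eq_abs,
    sq_abs, hs, if_true, ← sub_eq_add_neg, Bool.false_eq_true, if_false]
  linarith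

theorem hadamardAnswer_hadamardAnswer {W : Type} (v : ι × Bool × W → ℂ) :
    hadamardAnswer ι W (hadamardAnswer ι W v) = v := by
  ext ⟨i, b, w⟩
  have h := ofReal_inv_sqrt_two_mul_self
  cases b <;> simp only [hadamardAnswer_apply, if_true, Bool.false_eq_true, if_false]
  · linear_combination 2 * v (i, false, w) * h
  · linear_combination 2 * v (i, true, w) * h

/-- Phase kickback: conjugation by the Hadamard gate turns the XOR oracle into the phase oracle. -/
theorem hadamardAnswer_oracle {W : Type} (x : ι → Bool) (v : ι × Bool × W → ℂ) :
    hadamardAnswer ι W (QuantumQueryAlgorithm.oracle x v) =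
      fun k => if (k.2.1 && x k.1) then -hadamardAnswer ι W v k else hadamardAnswer ι W v k := by
  ext ⟨i, b, w⟩
  cases b <;> cases hx : x i <;>
    simp [hadamardAnswer_apply, QuantumQueryAlgorithm.oracle, hx] <;> ring

/-- Applying in every branch `w` of the workspace its own isometry. -/
noncomputable def branchwise [Fintype ι] {W : Type}
    (V : W → EuclideanSpace ℂ (ι × Bool) →ₗᵢ[ℂ] EuclideanSpace ℂ (ι × Bool)) :
    (ι × Bool × W → ℂ) →ₗ[ℂ] (ι × Bool × W → ℂ) where
  toFun v k := V k.2.2 (WithLp.toLp 2 fun j => v (j.1, j.2, k.2.2)) (k.1, k.2.1)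
  map_add' v w := by
    ext k
    rw [Pi.add_apply, ← PiLp.add_apply, ← map_add]
    rfl
  map_smul' c v := by
    ext k
    rw [Pi.smul_apply, RingHom.id_apply, ← PiLp.smul_apply, ← map_smul]
    rfl

theorem branchwise_apply [Fintype ι] {W : Type}
    (V : W → EuclideanSpace ℂ (ι × Bool) →ₗᵢ[ℂ] EuclideanSpace ℂ (ι × Bool))
    (v : ι × Bool × W → ℂ) (k : ι × Bool × W) :
    branchwise V v k = V k.2.2 (WithLp.toLp 2 fun j => v (j.1, j.2, k.2.2)) (k.1, k.2.1) := rfl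

theorem sum_norm_sq_branchwise [Fintype ι] {W : Type} [Fintype W]
    (V : W → EuclideanSpace ℂ (ι × Bool) →ₗᵢ[ℂ] EuclideanSpace ℂ (ι × Bool))
    (v : ι × Bool × W → ℂ) :
    ∑ k, ‖branchwise V v k‖ ^ 2 = ∑ k, ‖v k‖ ^ 2 := by
  have hswap : ∀ u : ι × Bool × W → ℂ,
      ∑ k, ‖u k‖ ^ 2 = ∑ w, ∑ j : ι × Bool, ‖u (j.1, j.2, w)‖ ^ 2 := by
    intro u
    rw [← (Equiv.prodAssoc ι Bool W).sum_comp, Fintype.sum_prod_type_right]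
    rfl
  rw [hswap, hswap]
  refine Finset.sum_congr rfl fun w _ => ?_
  simp only [branchwise_apply, Prod.mk.eta]
  rw [← EuclideanSpace.norm_sq_eq, LinearIsometry.norm_map, EuclideanSpace.norm_sq_eq]

/-- Applying an isometry to the workspace. -/
noncomputable def onWork {W : Type} [Fintype W] (F : EuclideanSpace ℂ W →ₗᵢ[ℂ] EuclideanSpace ℂ W) :
    (ι × Bool × W → ℂ) →ₗ[ℂ] (ι × Bool × W → ℂ) where
  toFun v k := F (WithLp.toLp 2 fun w => v (k.1, k.2.1, w)) k.2.2
  map_add' v w := by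
    ext k
    rw [Pi.add_apply, ← PiLp.add_apply, ← map_add]
    rfl
  map_smul' c v := by
    ext k
    rw [Pi.smul_apply, RingHom.id_apply, ← PiLp.smul_apply, ← map_smul]
    rfl

theorem onWork_apply {W : Type} [Fintype W] (F : EuclideanSpace ℂ W →ₗᵢ[ℂ] EuclideanSpace ℂ W)
    (v : ι × Bool × W → ℂ) (k : ι × Bool × W) :
    onWork F v k = F (WithLp.toLp 2 fun w => v (k.1, k.2.1, w)) k.2.2 := rfl

theorem sum_norm_sq_onWork [Fintype ι] {W : Type} [Fintype W]
    (F : EuclideanSpace ℂ W →ₗᵢ[ℂ] EuclideanSpace ℂ W) (v : ι × Bool × W → ℂ) :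
    ∑ k, ‖onWork F v k‖ ^ 2 = ∑ k, ‖v k‖ ^ 2 := by
  simp only [Fintype.sum_prod_type, onWork_apply]
  refine Finset.sum_congr rfl fun i _ => Finset.sum_congr rfl fun b _ => ?_
  rw [← EuclideanSpace.norm_sq_eq, LinearIsometry.norm_map, EuclideanSpace.norm_sq_eq]

/-- Extend the uniform vector to an orthonormal basis and take coordinates; this serves in place of
a Fourier transform. -/
theorem exists_isometry_uniform (T : ℕ) [NeZero T] :
    ∃ F : EuclideanSpace ℂ (Fin T) ≃ₗᵢ[ℂ] EuclideanSpace ℂ (Fin T),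
      (∀ m, F.symm (EuclideanSpace.single 0 1) m = ((Real.sqrt T)⁻¹ : ℝ)) ∧
      ∀ v, F v 0 = ((Real.sqrt T)⁻¹ : ℝ) * ∑ m, v m := by
  have hT : (0 : ℝ) < T := Nat.cast_pos.mpr (NeZero.pos T)
  let u : EuclideanSpace ℂ (Fin T) := WithLp.toLp 2 fun _ => (((Real.sqrt T)⁻¹ : ℝ) : ℂ)
  have hu : ‖u‖ = 1 := by
    rw [EuclideanSpace.norm_eq, Real.sqrt_eq_one]
    simp [u, inv_pow, Real.sq_sqrt hT.le, hT.ne']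
  have ho : Orthonormal ℂ (({0} : Set (Fin T)).domRestrict fun _ => u) := by
    refine ⟨fun _ => hu, fun i j hij => (hij (Subsingleton.elim i j)).elim⟩
  obtain ⟨b, hb⟩ := ho.exists_orthonormalBasis_extension_of_card_eq (by simp)
  have hb0 : b 0 = u := hb 0 rfl
  refine ⟨b.repr, fun m => ?_, fun v => ?_⟩
  · rw [b.repr_symm_single, hb0]
  · rw [b.repr_apply_apply, hb0, PiLp.inner_apply, Finset.mul_sum]
    refine Finset.sum_congr rfl fun m _ => ?_
    simp [u, mul_comm]

/-- One-sided phase detection without controlled queries: for an isometry `V` and a basis state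
that the phase oracle fixes, `T` queries suffice to accept with the squared norm of the average of
the first `T` iterates of the basis state under `phaseOracle x ∘ V`. -/
theorem exists_phaseDetection [Fintype ι] [DecidableEq ι] (T : ℕ) (hT : T ≠ 0) (i₀ : ι)
    (V : EuclideanSpace ℂ (ι × Bool) →ₗᵢ[ℂ] EuclideanSpace ℂ (ι × Bool)) :
    ∃ A : QuantumQueryAlgorithm ι, A.queries = T ∧ ∀ x, A.acceptProb x =
      (‖∑ m ∈ Finset.range T, ((phaseOracle x).comp V)^[m]
        (EuclideanSpace.single (i₀, false) 1)‖ / T) ^ 2 := by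
  have : NeZero T := ⟨hT⟩
  obtain ⟨F, hF, hF'⟩ := exists_isometry_uniform T
  set ψ : EuclideanSpace ℂ (ι × Bool) := EuclideanSpace.single (i₀, false) 1 with hψ
  -- Branch `m` idles for the first `T - m` steps and then applies `V` in the remaining `m`, so it
  -- ends in `U^[m] ψ`. Queries made while idling are harmless because the phase oracle fixes `ψ`;
  -- no controlled query is needed.
  let B : ℕ → Fin T → EuclideanSpace ℂ (ι × Bool) →ₗᵢ[ℂ] EuclideanSpace ℂ (ι × Bool) :=
    fun k m => if T ≤ m + k then V else LinearIsometry.id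
  obtain ⟨MH, hMH⟩ := exists_unitaryGroup_mulVec_eq (hadamardAnswer ι (Fin T))
    sum_norm_sq_hadamardAnswer
  obtain ⟨MF, hMF⟩ := exists_unitaryGroup_mulVec_eq (onWork (ι := ι) F.toLinearIsometry)
    (sum_norm_sq_onWork _)
  obtain ⟨MS, hMS⟩ := exists_unitaryGroup_mulVec_eq (onWork (ι := ι) F.symm.toLinearIsometry)
    (sum_norm_sq_onWork _)
  choose MB hMB using fun k => exists_unitaryGroup_mulVec_eq (branchwise (B k))
    (sum_norm_sq_branchwise _)
  let A : QuantumQueryAlgorithm ι :=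
    { Work := Fin T
      workFintype := inferInstance
      workDecidableEq := inferInstance
      queries := T
      unitary := fun k => if k = 0 then MH * MB 0 * MS else
        if k < T then MH * MB k * MH else MF * MH
      start := (i₀, false, 0)
      accepting := Finset.univ.filter fun k => k.2.2 = 0 }
  refine ⟨A, rfl, fun x => ?_⟩
  set U := (phaseOracle x).comp V
  set c : ℂ := (((Real.sqrt T)⁻¹ : ℝ) : ℂ) with hc
  have hPψ : phaseOracle x ψ = ψ := by
    ext j
    rw [phaseOracle_apply]
    split_ifs with h
    · have : j ≠ (i₀, false) := by
        rintro rfl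
        simp at h
      simp [hψ, this]
    · rfl
  have hAk : ∀ k, k ≠ 0 → k < T → A.unitary k = MH * MB k * MH := fun k h0 h1 => by
    change (if k = 0 then _ else if k < T then _ else _) = _
    rw [if_neg h0, if_pos h1]
  have hAT : A.unitary T = MF * MH := by
    change (if T = 0 then _ else if T < T then _ else _) = _
    rw [if_neg hT, if_neg (lt_irrefl _)]
  -- Truncated subtraction makes the exponent `0` throughout the idle phase of a branch.
  have hstep : ∀ k (v : ι × Bool × Fin T → ℂ),
      (∀ j m, v (j.1, j.2, m) = c * (U^[m + k - T] ψ) j) → ∀ j m,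
      hadamardAnswer ι (Fin T) (QuantumQueryAlgorithm.oracle x
        (hadamardAnswer ι (Fin T) (branchwise (B k) v))) (j.1, j.2, m) =
        c * (U^[m + (k + 1) - T] ψ) j := by
    intro k v hv j m
    have hv' : (WithLp.toLp 2 fun j : ι × Bool => v (j.1, j.2, m)) =
        c • U^[m + k - T] ψ := by
      ext j
      exact hv j m
    have hb : (phaseOracle x) (B k m (U^[m + k - T] ψ)) = U^[m + (k + 1) - T] ψ := by
      by_cases h : T ≤ m + k
      · have he : (m : ℕ) + (k + 1) - T = m + k - T + 1 := by omega
        rw [he, Function.iterate_succ_apply']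
        simp only [B, if_pos h]
        rfl
      · have he : (m : ℕ) + (k + 1) - T = 0 := by omega
        have he' : (m : ℕ) + k - T = 0 := by omega
        rw [he, he']
        simp only [B, if_neg h]
        exact hPψ
    rw [hadamardAnswer_oracle, hadamardAnswer_hadamardAnswer, ← hb, phaseOracle_apply]
    simp only [branchwise_apply, hv', map_smul, PiLp.smul_apply, smul_eq_mul, Prod.mk.eta]
    split_ifs <;> ring
  have hmain : ∀ k, k < T → ∀ j m,
      hadamardAnswer ι (Fin T) (QuantumQueryAlgorithm.oracle x (A.state x k)) (j.1, j.2, m) =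
        c * (U^[m + (k + 1) - T] ψ) j := by
    intro k
    induction k with
    | zero =>
      intro _
      have hs : A.state x 0 = hadamardAnswer ι (Fin T) (branchwise (B 0)
          (onWork F.symm.toLinearIsometry (Pi.single (i₀, false, 0) 1))) := by
        rw [← hMH, ← hMB, ← hMS, Matrix.mulVec_mulVec, Matrix.mulVec_mulVec]
        rfl
      rw [hs]
      refine hstep 0 _ fun j m => ?_
      have he : (m : ℕ) + 0 - T = 0 := by omega
      rw [he, onWork_apply]
      by_cases hj : j = (i₀, false)
      · subst hj
        have : (WithLp.toLp 2 fun w : Fin T =>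
            (Pi.single (i₀, false, 0) 1 : ι × Bool × Fin T → ℂ) (i₀, false, w)) =
            EuclideanSpace.single 0 1 := by
          ext w
          simp [Pi.single_apply]
        rw [this]
        simpa [hψ] using hF m
      · have : (WithLp.toLp 2 fun w : Fin T =>
            (Pi.single (i₀, false, 0) 1 : ι × Bool × Fin T → ℂ) (j.1, j.2, w)) = 0 := by
          ext w
          have : (j.1, j.2, w) ≠ (i₀, false, 0) := fun h => hj (by
            simp only [Prod.mk.injEq] at h
            exact Prod.ext h.1 h.2.1)
          simp [this]
        rw [this, map_zero]
        simp [hψ, hj]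
    | succ k ih =>
      intro hk
      have hs : A.state x (k + 1) = hadamardAnswer ι (Fin T) (branchwise (B (k + 1))
          (hadamardAnswer ι (Fin T) (QuantumQueryAlgorithm.oracle x (A.state x k)))) := by
        rw [QuantumQueryAlgorithm.state, hAk _ k.succ_ne_zero hk, ← hMH, ← hMB, ← hMH,
          Matrix.mulVec_mulVec, Matrix.mulVec_mulVec]
        rfl
      rw [hs]
      exact hstep (k + 1) _ (ih (by omega))
  have hfin : ∀ j : ι × Bool, A.state x T (j.1, j.2, 0) =
      (T : ℂ)⁻¹ * (∑ m ∈ Finset.range T, U^[m] ψ) j := by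
    intro j
    obtain ⟨q, rfl⟩ := Nat.exists_eq_add_one_of_ne_zero hT
    have hs : A.state x (q + 1) = onWork F.toLinearIsometry
        (hadamardAnswer ι (Fin (q + 1)) (QuantumQueryAlgorithm.oracle x (A.state x q))) := by
      rw [QuantumQueryAlgorithm.state, hAT, ← hMF, ← hMH, Matrix.mulVec_mulVec]
      rfl
    have hcc : c * c = ((q + 1 : ℕ) : ℂ)⁻¹ := by
      rw [hc, ← Complex.ofReal_mul, ← mul_inv, Real.mul_self_sqrt (Nat.cast_nonneg _)]
      simp
    change A.state x (q + 1) _ = _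
    rw [hs, onWork_apply]
    refine (hF' _).trans ?_
    simp only
    rw [Finset.sum_congr rfl fun m _ => hmain q (Nat.lt_succ_self q) j m, ← Finset.mul_sum,
      ← mul_assoc, hcc]
    simp only [Nat.add_sub_cancel]
    rw [Fin.sum_univ_eq_sum_range (fun m => (U^[m] ψ) j), WithLp.ofLp_sum, Finset.sum_apply]
  have hacc : A.acceptProb x = ∑ j : ι × Bool, ‖A.state x T (j.1, j.2, 0)‖ ^ 2 := by
    change ∑ k ∈ Finset.univ.filter (fun k : ι × Bool × Fin T => k.2.2 = 0),
      ‖A.state x T k‖ ^ 2 = _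
    rw [Finset.sum_filter,
      ← (Equiv.prodAssoc ι Bool (Fin T)).sum_comp, Fintype.sum_prod_type]
    simp
  rw [hacc, div_pow, EuclideanSpace.norm_sq_eq, Finset.sum_div]
  refine Finset.sum_congr rfl fun j _ => ?_
  rw [hfin, norm_mul, mul_pow, norm_inv, Complex.norm_natCast]
  field_simp

end PhaseDetection

/-! ### Flows and potentials for `s`-`t` connectivity -/

section STConnectivity

variable {n : ℕ}

/-- The vector of potential differences of `p` along all ordered pairs of vertices, with the
difference along `(s, t)` itself, scaled by `a⁻¹`, recorded in the extra coordinate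
`((s, t), false)`. -/
noncomputable def potentialDiff (s t : Fin n) (a : ℝ) :
    (Fin n → ℂ) →ₗ[ℂ] EuclideanSpace ℂ ((Fin n × Fin n) × Bool) where
  toFun p := WithLp.toLp 2 fun j =>
    if j.2 then p j.1.1 - p j.1.2 else if j.1 = (s, t) then (a : ℂ)⁻¹ * (p s - p t) else 0
  map_add' p q := by
    ext j
    simp only [PiLp.add_apply, Pi.add_apply]
    split_ifs <;> ring
  map_smul' c p := by
    ext j
    simp only [PiLp.smul_apply, Pi.smul_apply, smul_eq_mul, RingHom.id_apply]
    split_ifs <;> ring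

theorem potentialDiff_apply (s t : Fin n) (a : ℝ) (p : Fin n → ℂ)
    (j : (Fin n × Fin n) × Bool) :
    potentialDiff s t a p j =
      if j.2 then p j.1.1 - p j.1.2 else if j.1 = (s, t) then (a : ℂ)⁻¹ * (p s - p t) else 0 :=
  rfl

/-- The isometry of the algorithm: the reflection fixing the circulations, followed by a sign flip
of the edge coordinates. -/
noncomputable def circulationReflection (s t : Fin n) (a : ℝ) :
    EuclideanSpace ℂ ((Fin n × Fin n) × Bool) →ₗᵢ[ℂ] EuclideanSpace ℂ ((Fin n × Fin n) × Bool) :=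
  (phaseOracle fun _ => true).comp
    (LinearMap.range (potentialDiff s t a))ᗮ.reflection.toLinearIsometry

/-- The two sign flips cancel on present edges, leaving a flip of exactly the absent ones. -/
theorem phaseOracle_circulationReflection_apply (x : Fin n × Fin n → Bool) (s t : Fin n) (a : ℝ)
    (v : EuclideanSpace ℂ ((Fin n × Fin n) × Bool)) (j : (Fin n × Fin n) × Bool) :
    (phaseOracle x).comp (circulationReflection s t a) v j =
      if (j.2 && !x j.1) then
        -((LinearMap.range (potentialDiff s t a))ᗮ.reflection v j)
      else (LinearMap.range (potentialDiff s t a))ᗮ.reflection v j := by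
  change phaseOracle x (phaseOracle (fun _ => true) _) j = _
  rw [phaseOracle_apply, phaseOracle_apply]
  cases hj : j.2 <;> cases hx : x j.1 <;> simp

theorem sum_darts_sub {G : SimpleGraph (Fin n)} {u v : Fin n} (w : G.Walk u v) (p : Fin n → ℂ) :
    ((w.darts.map SimpleGraph.Dart.toProd).map fun e => p e.1 - p e.2).sum = p u - p v := by
  induction w with
  | nil => simp
  | cons h w ih =>
    simp only [SimpleGraph.Walk.darts_cons, List.map_cons, List.sum_cons, ih]
    ring

theorem exists_fixed_of_path {G : SimpleGraph (Fin n)} {s t : Fin n} (w : G.Walk s t)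
    (hw : w.IsPath) {a : ℝ} (ha : 0 < a) :
    ∃ φ : EuclideanSpace ℂ ((Fin n × Fin n) × Bool),
      (phaseOracle (adjacencyInput n G)).comp (circulationReflection s t a) φ = φ ∧
      ‖φ‖ ^ 2 ≤ a ^ 2 + w.length ∧
      ⟪φ, EuclideanSpace.single ((s, t), false) 1⟫_ℂ = a := by
  set D := w.darts.map SimpleGraph.Dart.toProd with hD
  have hnd : D.Nodup := (SimpleGraph.Walk.darts_nodup_of_support_nodup hw.support_nodup).map
    fun _ _ h => SimpleGraph.Dart.ext _ _ h
  -- Flow `-1` along the path and `a` on the virtual edge: the scaling `a⁻¹` in `potentialDiff`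
  -- makes the two contributions cancel against every potential.
  let φ : EuclideanSpace ℂ ((Fin n × Fin n) × Bool) := WithLp.toLp 2 fun j =>
    if j.2 then (if j.1 ∈ D.toFinset then -1 else 0) else if j.1 = (s, t) then (a : ℂ) else 0
  have hφ : φ ∈ (LinearMap.range (potentialDiff s t a))ᗮ := by
    rw [Submodule.mem_orthogonal']
    rintro _ ⟨p, rfl⟩
    rw [PiLp.inner_apply, Fintype.sum_prod_type]
    simp only [Fintype.sum_bool, potentialDiff_apply, φ, if_true, Bool.false_eq_true, if_false]
    rw [Finset.sum_add_distrib]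
    have h1 : ∑ e : Fin n × Fin n, ⟪if e ∈ D.toFinset then (-1 : ℂ) else 0, p e.1 - p e.2⟫_ℂ =
        -(p s - p t) := by
      have hterm : ∀ e : Fin n × Fin n,
          ⟪if e ∈ D.toFinset then (-1 : ℂ) else 0, p e.1 - p e.2⟫_ℂ =
            if e ∈ D.toFinset then -(p e.1 - p e.2) else 0 := fun e => by
        split_ifs <;> simp
      rw [Finset.sum_congr rfl fun e _ => hterm e, Finset.sum_ite_mem, Finset.univ_inter,
        Finset.sum_neg_distrib, List.sum_toFinset _ hnd, sum_darts_sub w p]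
    have h2 : ∑ e : Fin n × Fin n, ⟪if e = (s, t) then (a : ℂ) else 0,
        if e = (s, t) then (a : ℂ)⁻¹ * (p s - p t) else 0⟫_ℂ = p s - p t := by
      rw [Finset.sum_eq_single (s, t)]
      · have : (a : ℂ) ≠ 0 := Complex.ofReal_ne_zero.mpr ha.ne'
        simp only [if_true, RCLike.inner_apply, Complex.conj_ofReal]
        field_simp
      · intro e _ he
        simp [he]
      · simp
    rw [h1, h2]
    ring
  refine ⟨φ, ?_, ?_, ?_⟩
  · ext j
    rw [phaseOracle_circulationReflection_apply, Submodule.reflection_mem_subspace_eq_self hφ]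
    split_ifs with h
    · have h' : j.1 ∉ D.toFinset := by
        intro hmem
        rw [List.mem_toFinset, hD, List.mem_map] at hmem
        obtain ⟨e, -, he⟩ := hmem
        have := e.adj
        simp only [adjacencyInput, Bool.and_eq_true, Bool.not_eq_true', decide_eq_false_iff_not,
          ← he] at h
        exact h.2 this
      simp only [Bool.and_eq_true] at h
      simp [φ, h.1, h']
    · rfl
  · rw [EuclideanSpace.norm_sq_eq, Fintype.sum_prod_type]
    simp only [Fintype.sum_bool, φ, if_true, Bool.false_eq_true, if_false]
    rw [Finset.sum_add_distrib, add_comm]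
    refine add_le_add (le_of_eq ?_) ?_
    · rw [Finset.sum_eq_single (s, t)]
      · simp
      · intro e _ he
        simp [he]
      · simp
    · have : ∀ e : Fin n × Fin n, ‖if e ∈ D.toFinset then (-1 : ℂ) else 0‖ ^ 2 =
          if e ∈ D.toFinset then (1 : ℝ) else 0 := fun e => by split_ifs <;> simp
      simp only [this, Finset.sum_ite_mem, Finset.univ_inter, Finset.sum_const, nsmul_eq_mul,
        mul_one]
      have hl : D.length = w.length := by simp [hD]
      exact_mod_cast hl ▸ List.toFinset_card_le D
  · rw [EuclideanSpace.inner_single_right]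
    simp [φ]

theorem exists_coboundary_of_not_reachable {G : SimpleGraph (Fin n)} {s t : Fin n}
    (h : ¬ G.Reachable s t) {a : ℝ} (ha : 0 < a) :
    ∃ φ : EuclideanSpace ℂ ((Fin n × Fin n) × Bool),
      (2 : ℂ) • EuclideanSpace.single ((s, t), false) 1 =
        φ - (phaseOracle (adjacencyInput n G)).comp (circulationReflection s t a) φ ∧
      ‖φ‖ ^ 2 ≤ 1 + a ^ 2 * n ^ 2 := by
  classical
  -- The height `a` gives the virtual edge the value `1`. Differences vanish on present edges, so
  -- after the reflection negates everything, the flip of absent edges restores all but the marked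
  -- coordinate.
  let p : Fin n → ℂ := fun v => if G.Reachable s v then (a : ℂ) else 0
  have hps : p s = a := if_pos (SimpleGraph.Reachable.refl s)
  have hpt : p t = 0 := if_neg h
  have ha' : (a : ℂ) ≠ 0 := Complex.ofReal_ne_zero.mpr ha.ne'
  have hadj : ∀ u v, G.Adj u v → p u = p v := fun u v huv => by
    have : G.Reachable s u ↔ G.Reachable s v :=
      ⟨fun hu => hu.trans huv.reachable, fun hv => hv.trans huv.symm.reachable⟩
    simp only [p, this]
  refine ⟨potentialDiff s t a p, ?_, ?_⟩
  · have hr : (LinearMap.range (potentialDiff s t a))ᗮ.reflection (potentialDiff s t a p) =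
        -potentialDiff s t a p := by
      apply Submodule.reflection_mem_subspace_orthogonal_precomplement_eq_neg
      exact LinearMap.mem_range_self _ p
    ext ⟨⟨u, v⟩, b⟩
    rw [PiLp.sub_apply, phaseOracle_circulationReflection_apply, hr]
    simp only [PiLp.neg_apply, potentialDiff_apply, PiLp.smul_apply, PiLp.single_apply, hps, hpt]
    cases b
    · by_cases he : (u, v) = (s, t)
      · simp [he, ha']
        norm_num
      · simp [he]
    · by_cases huv : G.Adj u v
      · simp [adjacencyInput, huv, hadj u v huv]
      · simp [adjacencyInput, huv]
  · rw [EuclideanSpace.norm_sq_eq, Fintype.sum_prod_type]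
    simp only [Fintype.sum_bool, potentialDiff_apply, if_true, Bool.false_eq_true, if_false]
    rw [Finset.sum_add_distrib, add_comm]
    refine add_le_add (le_of_eq ?_) ?_
    · rw [Finset.sum_eq_single (s, t)]
      · simp [hps, hpt, ha']
      · intro e _ he
        simp [he]
      · simp
    · have hle : ∀ e ∈ (Finset.univ : Finset (Fin n × Fin n)), ‖p e.1 - p e.2‖ ^ 2 ≤ a ^ 2 := by
        intro e _
        simp only [p]
        split_ifs <;> simp [sq_nonneg]
      refine (Finset.sum_le_card_nsmul _ _ _ hle).trans (le_of_eq ?_)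
      simp [Fintype.card_prod]
      ring

theorem exists_constant_algorithm {ι : Type} [Fintype ι] [DecidableEq ι] (i : ι) (b : Bool) :
    ∃ A : QuantumQueryAlgorithm ι, A.queries = 0 ∧
      ∀ x, A.acceptProb x = if b then 1 else 0 := by
  refine ⟨{ Work := Unit, workFintype := inferInstance, workDecidableEq := inferInstance,
            queries := 0, unitary := fun _ => 1, start := (i, false, ()),
            accepting := if b then {(i, false, ())} else ∅ }, rfl, fun x => ?_⟩
  cases b <;> simp [QuantumQueryAlgorithm.acceptProb, QuantumQueryAlgorithm.state]

end STConnectivity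

/-! ### Choice of parameters -/

theorem theorem3p1 :
    ∃ C : ℝ, 0 < C ∧ ∀ (n d : ℕ) (s t : Fin n),
      ∃ A : QuantumQueryAlgorithm (Fin n × Fin n),
        (A.queries : ℝ) ≤ C * (n * Real.sqrt d) ∧
        A.Decides (adjacencyInput n) (ShortPathPromise s t d) (fun G => G.Reachable s t) := by
  refine ⟨4, by norm_num, fun n d s t => ?_⟩
  -- For `d = 0` no query is allowed, but the promise reduces the question to whether `s = t`.
  rcases Nat.eq_zero_or_pos d with rfl | hd
  · obtain ⟨A, hA, hacc⟩ := exists_constant_algorithm (s, t) (decide (s = t))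
    refine ⟨A, by simp [hA], fun G hG => ⟨fun h => ?_, fun h => ?_⟩⟩
    · obtain ⟨w, -, hw⟩ := hG h
      have hst : s = t := SimpleGraph.Walk.eq_of_length_eq_zero (Nat.le_zero.mp hw)
      rw [hacc, if_pos (by simpa using hst)]
      norm_num
    · have hst : s ≠ t := fun hst => h (hst ▸ SimpleGraph.Reachable.refl s)
      rw [hacc, if_neg (by simpa using hst)]
      norm_num
  have hn1 : (1 : ℝ) ≤ n := by exact_mod_cast s.pos
  have hd1 : (1 : ℝ) ≤ d := by exact_mod_cast hd
  have hsd : Real.sqrt d ^ 2 = d := Real.sq_sqrt (by linarith)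
  have hsd1 : 1 ≤ Real.sqrt d := Real.one_le_sqrt.mpr hd1
  have hnd1 : 1 ≤ n * Real.sqrt d := one_le_mul_of_one_le_of_one_le hn1 hsd1
  set T := ⌈3 * (n * Real.sqrt d)⌉₊ with hTdef
  have hTge : 3 * (n * Real.sqrt d) ≤ T := Nat.le_ceil _
  -- Rounding up costs at most `1 ≤ n * √d`, whence the constant `4`.
  have hTle : (T : ℝ) ≤ 4 * (n * Real.sqrt d) := by
    have := (Nat.ceil_lt_add_one (by positivity : 0 ≤ 3 * (n * Real.sqrt d))).le
    linarith
  have hTpos : (0 : ℝ) < T := by linarith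
  have hT0 : T ≠ 0 := fun h => by simp [h] at hTpos
  -- This weight gives acceptance at least `a ^ 2 / (a ^ 2 + d) = 2/3` on connected instances, and
  -- at most `(1 + 2 * d * n ^ 2) / T ^ 2 ≤ 3 / 9` on the others.
  set a := Real.sqrt (2 * d) with hadef
  have ha : 0 < a := Real.sqrt_pos.mpr (by linarith)
  have ha2 : a ^ 2 = 2 * d := Real.sq_sqrt (by linarith)
  obtain ⟨A, hA, hacc⟩ := exists_phaseDetection T hT0 (s, t) (circulationReflection s t a)
  refine ⟨A, by rw [hA]; exact hTle, fun G hG => ⟨fun h => ?_, fun h => ?_⟩⟩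
  · obtain ⟨w, hw, hwd⟩ := hG h
    obtain ⟨φ, hfix, hnorm, hinner⟩ := exists_fixed_of_path w hw ha
    have hle := norm_inner_le_norm_mul_norm_sum_iterate _ T
      (EuclideanSpace.single ((s, t), false) 1) φ hfix
    rw [hacc]
    set S := ‖∑ m ∈ Finset.range T, ((phaseOracle (adjacencyInput n G)).comp
      (circulationReflection s t a))^[m] (EuclideanSpace.single ((s, t), false) 1)‖
    rw [hinner, Complex.norm_real, Real.norm_of_nonneg ha.le] at hle
    have hsq : (T * a) ^ 2 ≤ (‖φ‖ * S) ^ 2 := pow_le_pow_left₀ (by positivity) hle 2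
    have hwd' : (w.length : ℝ) ≤ d := by exact_mod_cast hwd
    have hnorm' : ‖φ‖ ^ 2 ≤ 3 * d := by linarith
    have h3 : (T : ℝ) ^ 2 * (2 * d) ≤ 3 * d * S ^ 2 := by
      rw [mul_pow, mul_pow, ha2] at hsq
      exact hsq.trans (mul_le_mul_of_nonneg_right hnorm' (sq_nonneg _))
    rw [div_pow, le_div_iff₀ (by positivity)]
    have h4 : (d : ℝ) * (2 * T ^ 2) ≤ d * (3 * S ^ 2) := by linarith
    have := le_of_mul_le_mul_left h4 (by linarith)
    linarith
  · obtain ⟨φ, hcob, hnorm⟩ := exists_coboundary_of_not_reachable h ha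
    have hle := norm_sum_iterate_le_of_coboundary _ T _ φ hcob
    rw [hacc, div_pow, div_le_iff₀ (by positivity)]
    have h1 := (pow_le_pow_left₀ (norm_nonneg _) hle 2).trans hnorm
    have h2 : (3 * (n * Real.sqrt d)) ^ 2 ≤ (T : ℝ) ^ 2 :=
      pow_le_pow_left₀ (by positivity) hTge 2
    have h3 : 1 ≤ (n * Real.sqrt d) ^ 2 := one_le_pow₀ hnd1
    rw [mul_pow, mul_pow, hsd] at h2
    rw [mul_pow, hsd] at h3
    rw [ha2] at h1
    refine h1.trans ?_
    linarith
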